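/- For a real analytic function $f:\mathbb R\to\mathbb R$ let $\mathcal M_f=(\mathbb R^4,g_f)$ be the pseudo-Riemannian manifold with coordinates $(x,y,\tilde x,\tilde y)$ and metric whose non-zero components are, up to symmetry, $g_f(\partial_x,\partial_x)=-2f(y)$ and $g_f(\partial_x,\partial_{\tilde x})=g_f(\partial_y,\partial_{\tilde y})=1$. A pseudo-Riemannian manifold $\mathcal M$ is said to be $k$-modeled on a homogeneous space $\mathcal N$ (a pseudo-Riemannian manifold whose isometry group acts transitively) if there is a point $Q\in\mathcal N$ such that for every point $P\in\mathcal M$ there is a linear isomorphism $\Phi_P:T_P\mathcal M\to T_Q\mathcal N$ with $\Phi_P^*g_{\mathcal N}=g_{\mathcal M}$ and $\Phi_P^*\nabla^iR_{\mathcal N}=\nabla^iR_{\mathcal M}$ for $0\le i\le k$, where $\nabla^iR$ is the $i$-th covariant derivative of the $(0,4)$ curvature tensor. A symmetric space is one in which every point is fixed by an isometry whose differential there is $-\mathrm{id}$; it is irreducible if its holonomy group at each point leaves no proper non-zero subspace on which the metric is non-degenerate invariant (irreducibility in the sense of the de Rham–Wu decomposition). Then: (1) $\mathcal M_{y^2}$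 is an irreducible symmetric space, it is homogeneous, and if $f$ is real analytic with $f''>0$ on $\mathbb R$, then $\mathcal M_f$ is $0$-modeled on $\mathcal M_{y^2}$. (2) $\mathcal M_{e^y}$ is homogeneous, and if $f$ is real analytic with $f''>0$ and $f'''>0$ on $\mathbb R$, then $\mathcal M_f$ is $1$-modeled on $\mathcal M_{e^y}$. (3) Let $f_1,f_2$ be real analytic with $f_i''>0$ and $f_i'''>0$ on $\mathbb R$, and let $P_1,P_2\in\mathbb R^4$. There is an isometry $\phi$ from $\mathcal M_{f_1}$ onto $\mathcal M_{f_2}$ with $\phi(P_1)=P_2$ if and only if $\alpha_p(f_1)(P_1)=\alpha_p(f_2)(P_2)$ for all integers $p\ge2$, where $\alpha_p(f)=f^{(p+2)}\,(f'')^{p-1}\,(f''')^{-p}$ is evaluated at the $y$-coordinate of the point. -/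

import Mathlib

open scoped ContDiff

/-- A smooth pseudo-Riemannian metric on the manifold `ℝ^ι`, given by its matrix
`g_{ij} = g(∂_i, ∂_j)` in the standard global coordinates. All manifolds of the statement are
of this form, and `T_P ℝ^ι` is identified with `ι → ℝ` through the coordinate frame. -/
structure PseudoRiemannianMetric (ι : Type*) [Fintype ι] [DecidableEq ι] where
  /-- the components of the metric -/
  coeff : (ι → ℝ) → Matrix ι ι ℝ
  smooth : ∀ i j, ContDiff ℝ ∞ (fun p => coeff p i j)
  symm : ∀ p, (coeff p).IsSymm
  nondegenerate : ∀ p, IsUnit (coeff p).det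

/-- The partial derivative `∂_i h` at `p`. -/
noncomputable def partialDeriv {ι : Type*} [Fintype ι] [DecidableEq ι]
    (i : ι) (h : (ι → ℝ) → ℝ) (p : ι → ℝ) : ℝ :=
  fderiv ℝ h p (Pi.single i 1)

/-- The covariant `m`-tensor on `ℝ^ι` with components `T idx = T(∂_{idx 0}, …, ∂_{idx (m-1)})`. -/
noncomputable def tensorOfComponents {ι : Type*} [Fintype ι] [DecidableEq ι] {m : ℕ}
    (T : (Fin m → ι) → ℝ) : MultilinearMap ℝ (fun _ : Fin m => ι → ℝ) ℝ :=
  ∑ idx : Fin m → ι, T idx •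
    (MultilinearMap.mkPiAlgebra ℝ (Fin m) ℝ).compLinearMap
      (fun s => (LinearMap.proj (idx s) : (ι → ℝ) →ₗ[ℝ] ℝ))

/-- A `k`-model: a vector space `V` with a non-degenerate symmetric bilinear form and tensors
`A^i ∈ ⊗^{4+i} V^*` for `0 ≤ i ≤ k`. -/
structure CurvatureModel (k : ℕ) (V : Type*) [AddCommGroup V] [Module ℝ V] where
  /-- the inner product -/
  form : LinearMap.BilinForm ℝ V
  form_symm : form.IsSymm
  form_nondegenerate : form.Nondegenerate
  /-- the tensors `A^0, …, A^k` -/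
  A : ∀ i : Fin (k + 1), MultilinearMap ℝ (fun _ : Fin (4 + (i : ℕ)) => V) ℝ

/-- `Φ` is an isomorphism of `k`-models: a linear isomorphism which pulls the inner product and
the tensors of `U'` back to those of `U`. -/
def CurvatureModel.IsIso {k : ℕ} {V V' : Type*} [AddCommGroup V] [Module ℝ V]
    [AddCommGroup V'] [Module ℝ V'] (U : CurvatureModel k V) (U' : CurvatureModel k V')
    (Φ : V ≃ₗ[ℝ] V') : Prop :=
  (∀ u v : V, U'.form (Φ u) (Φ v) = U.form u v) ∧
  ∀ (i : Fin (k + 1)) (v : Fin (4 + (i : ℕ)) → V), U'.A i (fun s => Φ (v s)) = U.A i v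

namespace PseudoRiemannianMetric

variable {ι κ : Type*} [Fintype ι] [DecidableEq ι] [Fintype κ] [DecidableEq κ]

/-- The inner product `g_P` on the tangent space at `P`. -/
noncomputable def formAt (g : PseudoRiemannianMetric ι) (P : ι → ℝ) :
    LinearMap.BilinForm ℝ (ι → ℝ) :=
  Matrix.toBilin' (g.coeff P)

/-- The Christoffel symbol `Γ^l_{ij}` of the Levi-Civita connection:
`∇_{∂_i} ∂_j = ∑_l Γ^l_{ij} ∂_l`. -/
noncomputable def christoffel (g : PseudoRiemannianMetric ι) (l i j : ι) (p : ι → ℝ) : ℝ :=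
  1 / 2 * ∑ m, (g.coeff p)⁻¹ l m *
    (partialDeriv i (fun q => g.coeff q j m) p + partialDeriv j (fun q => g.coeff q i m) p
      - partialDeriv m (fun q => g.coeff q i j) p)

/-- The components `R(∂_a, ∂_b, ∂_c, ∂_d) = g((∇_{∂_a}∇_{∂_b} - ∇_{∂_b}∇_{∂_a})∂_c, ∂_d)` of the
curvature tensor. -/
noncomputable def curvature (g : PseudoRiemannianMetric ι) (p : ι → ℝ) (a b c d : ι) : ℝ :=
  ∑ m, g.coeff p m d *
    (partialDeriv a (g.christoffel m b c) p - partialDeriv b (g.christoffel m a c) p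
      + ∑ s, (g.christoffel s b c p * g.christoffel m a s p
        - g.christoffel s a c p * g.christoffel m b s p))

/-- The covariant derivative of a covariant `m`-tensor field in components; the direction of
differentiation is the last slot:
`(∇T)(∂_{i_1}, …, ∂_{i_m}; ∂_j) = ∂_j T_{i_1…i_m} - ∑_s ∑_l Γ^l_{j i_s} T_{i_1…l…i_m}`. -/
noncomputable def covDeriv (g : PseudoRiemannianMetric ι) {m : ℕ}
    (T : (ι → ℝ) → (Fin m → ι) → ℝ) (p : ι → ℝ) (idx : Fin (m + 1) → ι) : ℝ :=
  partialDeriv (idx (Fin.last m)) (fun q => T q (Fin.init idx)) p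
    - ∑ s : Fin m, ∑ l, g.christoffel l (idx (Fin.last m)) (Fin.init idx s) p *
        T p (Function.update (Fin.init idx) s l)

/-- The components of the `k`-th covariant derivative `∇^k R`. -/
noncomputable def nablaR (g : PseudoRiemannianMetric ι) :
    (k : ℕ) → (ι → ℝ) → (Fin (4 + k) → ι) → ℝ
  | 0 => fun p idx => g.curvature p (idx 0) (idx 1) (idx 2) (idx 3)
  | k + 1 => g.covDeriv (nablaR g k)

/-- The `k`-model `(T_P M, g_P, R_P, …, ∇^k R_P)` of a pseudo-Riemannian manifold at `P`. -/
noncomputable def modelAt (g : PseudoRiemannianMetric ι) (k : ℕ) (P : ι → ℝ) :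
    CurvatureModel k (ι → ℝ) where
  form := g.formAt P
  form_symm := by
    refine ⟨fun u v => ?_⟩
    have h := g.symm P
    simp only [formAt, Matrix.toBilin'_apply']
    rw [Matrix.dotProduct_mulVec, ← Matrix.mulVec_transpose, h.eq, dotProduct_comm]
  form_nondegenerate :=
    LinearMap.BilinForm.nondegenerate_toBilin'_of_det_ne_zero' _ (g.nondegenerate P).ne_zero
  A := fun i => tensorOfComponents (g.nablaR i P)

/-- `U` is a `k`-model for the manifold `(ℝ^ι, g)`: the model of `g` at every point is isomorphic
to `U`. -/
def HasModel (g : PseudoRiemannianMetric ι) {k : ℕ} {V : Type*} [AddCommGroup V] [Module ℝ V]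
    (U : CurvatureModel k V) : Prop :=
  ∀ P : ι → ℝ, ∃ Φ : (ι → ℝ) ≃ₗ[ℝ] V, (g.modelAt k P).IsIso U Φ

/-- `φ` is an isometry from `(ℝ^ι, g)` onto `(ℝ^κ, h)`: a diffeomorphism with `φ^* h = g`. -/
def IsIsometry (g : PseudoRiemannianMetric ι) (h : PseudoRiemannianMetric κ)
    (φ : (ι → ℝ) ≃ (κ → ℝ)) : Prop :=
  ContDiff ℝ ∞ φ ∧ ContDiff ℝ ∞ φ.symm ∧
  ∀ (p u v : ι → ℝ), h.formAt (φ p) (fderiv ℝ φ p u) (fderiv ℝ φ p v) = g.formAt p u v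

/-- The isometry group acts transitively. -/
def IsHomogeneous (g : PseudoRiemannianMetric ι) : Prop :=
  ∀ P Q : ι → ℝ, ∃ φ : (ι → ℝ) ≃ (ι → ℝ), g.IsIsometry g φ ∧ φ P = Q

/-- `g` is `k`-modeled on the homogeneous space `h`. -/
def IsModeledOn (k : ℕ) (g : PseudoRiemannianMetric ι) (h : PseudoRiemannianMetric κ) : Prop :=
  h.IsHomogeneous ∧ ∃ Q : κ → ℝ, g.HasModel (h.modelAt k Q)

/-- `g` is a (globally) symmetric space: every point `P` is fixed by an isometry whose
differential at `P` is `-id`. -/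
def IsSymmetricSpace (g : PseudoRiemannianMetric ι) : Prop :=
  ∀ P : ι → ℝ, ∃ φ : (ι → ℝ) ≃ (ι → ℝ), g.IsIsometry g φ ∧ φ P = P ∧
    fderiv ℝ φ P = -ContinuousLinearMap.id ℝ (ι → ℝ)

/-- `V` is a parallel vector field along the curve `γ`. -/
def IsParallelAlong (g : PseudoRiemannianMetric ι) (γ V : ℝ → ι → ℝ) : Prop :=
  ∀ t : ℝ, HasDerivAt V
    (fun l => -∑ i, ∑ j, g.christoffel l i j (γ t) * deriv γ t i * V t j) t

/-- The subspace `W` of `T_P ℝ^ι` is invariant under the holonomy group at `P`, that is, under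
parallel transport around all smooth loops based at `P`. -/
def IsHolonomyInvariant (g : PseudoRiemannianMetric ι) (P : ι → ℝ)
    (W : Submodule ℝ (ι → ℝ)) : Prop :=
  ∀ γ V : ℝ → ι → ℝ, ContDiff ℝ ∞ γ → γ 0 = P → γ 1 = P → g.IsParallelAlong γ V →
    V 0 ∈ W → V 1 ∈ W

/-- Irreducibility in the sense of the de Rham-Wu decomposition theorem for pseudo-Riemannian
manifolds: the holonomy group leaves no proper non-zero non-degenerate subspace invariant
(so the manifold is not a non-trivial product). For definite metrics every subspace is
non-degenerate, and this is the usual irreducibility. -/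
def IsIrreducible (g : PseudoRiemannianMetric ι) : Prop :=
  ∀ (P : ι → ℝ) (W : Submodule ℝ (ι → ℝ)), g.IsHolonomyInvariant P W →
    (∀ w ∈ W, (∀ w' ∈ W, g.formAt P w w' = 0) → w = 0) → W = ⊥ ∨ W = ⊤

end PseudoRiemannianMetric

/-- The generalized plane wave manifold `M_f = (ℝ⁴, g_f)`, for `f` real analytic on `ℝ`. The
coordinates `(x, y, x̃, ỹ)` carry the indices `0, 1, 2, 3`, and the non-zero components of `g_f`
are `g_f(∂_x, ∂_x) = -2 f(y)`, `g_f(∂_x, ∂_x̃) = g_f(∂_y, ∂_ỹ) = 1`, up to symmetry. -/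
noncomputable def planeWave (f : ℝ → ℝ) (hf : AnalyticOnNhd ℝ f Set.univ) :
    PseudoRiemannianMetric (Fin 4) where
  coeff := fun p => !![-2 * f (p 1), 0, 1, 0; 0, 0, 0, 1; 1, 0, 0, 0; 0, 1, 0, 0]
  smooth := by
    have h : ContDiff ℝ ∞ f := contDiffOn_univ.mp hf.contDiffOn_of_completeSpace
    have h' : ContDiff ℝ ∞ (fun p : Fin 4 → ℝ => -2 * f (p 1)) :=
      contDiff_const.mul (h.comp (contDiff_apply ℝ ℝ 1))
    intro i j
    fin_cases i <;> fin_cases j <;> first | exact h' | exact contDiff_const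
  symm := by
    intro p
    ext i j
    fin_cases i <;> fin_cases j <;> rfl
  nondegenerate := by
    intro p
    simp [Matrix.det_succ_row_zero, Fin.sum_univ_succ, Fin.succAbove]

/-- `M_{y²}`. -/
noncomputable def planeWaveSq : PseudoRiemannianMetric (Fin 4) :=
  planeWave (fun y => y ^ 2) (analyticOnNhd_id.pow 2)

/-- `M_{e^y}`. -/
noncomputable def planeWaveExp : PseudoRiemannianMetric (Fin 4) :=
  planeWave Real.exp analyticOnNhd_rexp

/-- `α_p(f) = f^{(p+2)} (f'')^{p-1} (f''')^{-p}`, for `p ≥ 2`. -/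
noncomputable def alphaInv (p : ℕ) (f : ℝ → ℝ) (y : ℝ) : ℝ :=
  iteratedDeriv (p + 2) f y * iteratedDeriv 2 f y ^ (p - 1) * (iteratedDeriv 3 f y ^ p)⁻¹

/-! The only Christoffel symbols of M_f are Γ^ỹ_xx = f' and Γ^x̃_xy = -f', up to symmetry. Their
values lie along ∂_x̃ and ∂_ỹ, directions they never accept as input, so all products of them drop
out: R is f'' times a constant tensor in dx, dy, and ∇R is f''' times that tensor times dy.
Rescaling x by a and y by b multiplies these by a²b² and a²b³, and a shear into x̃ repairs the
metric; this gives the modeling claims.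

Adding an affine function to f does not change the isometry class: `planeWaveMap` absorbs it, so a²
f₂(Q + bt) = f₁(P + t) + c + dt suffices for an isometry. Homogeneity and the point symmetries of
M_{y²} are instances. So is "if" in (3): a and b are fixed by the derivatives of orders 2 and 3, the
α_p match the higher ones, and analyticity concludes.

For "only if", dx and dy are parallel, so an isometry pulls x and y back to functions with zero
Hessian (`hessian_eq`), and f'' ≠ 0 makes these affine in x, y (`eq_affine_of_hessian_eq`).
Comparing metrics gives f₁''(y) = D f₂''(dy + e), and D and d cancel in α_p.

Irreducibility needs only the parallel transport around one loop of M_{y²}, which differs from the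
identity by a multiple of N : w ↦ (0, 0, w_y, -w_x). -/

theorem partialDeriv_comp_apply {ι : Type*} [Fintype ι] [DecidableEq ι] {h : ℝ → ℝ} {p : ι → ℝ}
    {k : ι} (hh : DifferentiableAt ℝ h (p k)) (i : ι) :
    partialDeriv i (fun q => h (q k)) p = if i = k then deriv h (p k) else 0 := by
  have h0 : HasFDerivAt (fun q : ι → ℝ => q k) (.proj k : (ι → ℝ) →L[ℝ] ℝ) p :=
    hasFDerivAt_apply k p
  have h1 := hh.hasDerivAt.comp_hasFDerivAt p h0
  rw [partialDeriv, show (fun q : ι → ℝ => h (q k)) = h ∘ fun q => q k from rfl, h1.fderiv]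
  by_cases hik : i = k
  · subst hik; simp
  · simp [hik, Ne.symm hik]

theorem partialDeriv_const {ι : Type*} [Fintype ι] [DecidableEq ι] (i : ι) (c : ℝ) (p : ι → ℝ) :
    partialDeriv i (fun _ => c) p = 0 := by
  simp [partialDeriv]

theorem tensorOfComponents_apply {ι : Type*} [Fintype ι] [DecidableEq ι] {m : ℕ}
    (T : (Fin m → ι) → ℝ) (v : Fin m → ι → ℝ) :
    tensorOfComponents T v = ∑ idx, T idx * ∏ s, v s (idx s) := by
  simp [tensorOfComponents]

theorem tensorOfComponents_single {ι : Type*} [Fintype ι] [DecidableEq ι] {m : ℕ}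
    (A : Fin m → ι) (v : Fin m → ι → ℝ) :
    tensorOfComponents (Pi.single A 1) v = ∏ s, v s (A s) := by
  simp [tensorOfComponents_apply, Pi.single_apply]

/-! ### Connection, curvature and ∇R of M_f. -/

section PlaneWave

variable {f : ℝ → ℝ} (hf : AnalyticOnNhd ℝ f Set.univ)

theorem planeWave_formAt (p u v : Fin 4 → ℝ) :
    (planeWave f hf).formAt p u v =
      -2 * f (p 1) * (u 0 * v 0) + u 0 * v 2 + u 2 * v 0 + u 1 * v 3 + u 3 * v 1 := by
  simp [PseudoRiemannianMetric.formAt, Matrix.toBilin'_apply, planeWave, Fin.sum_univ_four]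
  ring

theorem planeWave_inv_coeff (p : Fin 4 → ℝ) :
    ((planeWave f hf).coeff p)⁻¹ = !![0, 0, 1, 0; 0, 0, 0, 1; 1, 0, 2 * f (p 1), 0; 0, 1, 0, 0] := by
  apply Matrix.inv_eq_right_inv
  ext i j
  fin_cases i <;> fin_cases j <;> simp [planeWave, Matrix.mul_apply, Fin.sum_univ_four]

theorem planeWave_partialDeriv_coeff (i j m : Fin 4) (p : Fin 4 → ℝ) :
    partialDeriv i (fun q => (planeWave f hf).coeff q j m) p =
      if i = 1 ∧ j = 0 ∧ m = 0 then -2 * deriv f (p 1) else 0 := by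
  have hd : DifferentiableAt ℝ f (p 1) := (hf _ trivial).differentiableAt
  have h := partialDeriv_comp_apply (p := p) (k := 1) (hd.const_mul (-2)) i
  rw [deriv_const_mul _ hd] at h
  fin_cases j <;> fin_cases m <;>
    first
    | simpa [planeWave] using h
    | simp [planeWave, partialDeriv_const]

/-- The Christoffel symbols of `M_f` divided by `f'`. -/
def christoffelPattern (l i j : Fin 4) : ℝ :=
  (if l = 3 ∧ i = 0 ∧ j = 0 then 1 else 0) -
    if l = 2 ∧ (i = 0 ∧ j = 1 ∨ i = 1 ∧ j = 0) then 1 else 0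

theorem planeWave_christoffel (l i j : Fin 4) (p : Fin 4 → ℝ) :
    (planeWave f hf).christoffel l i j p = deriv f (p 1) * christoffelPattern l i j := by
  simp only [PseudoRiemannianMetric.christoffel, planeWave_partialDeriv_coeff,
    planeWave_inv_coeff, Fin.sum_univ_four, christoffelPattern]
  fin_cases l <;> fin_cases i <;> fin_cases j <;> simp

theorem christoffelPattern_eq_zero_of_lt {l : Fin 4} (hl : l < 2) (i j : Fin 4) :
    christoffelPattern l i j = 0 := by
  fin_cases l <;> simp_all [christoffelPattern]

theorem christoffelPattern_eq_zero_of_le {j : Fin 4} (hj : 2 ≤ j) (l i : Fin 4) :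
    christoffelPattern l i j = 0 := by
  fin_cases j <;> simp_all [christoffelPattern]

theorem christoffelPattern_mul (l l' i j k : Fin 4) :
    christoffelPattern l i j * christoffelPattern l' k l = 0 := by
  rcases lt_or_ge l 2 with h | h
  · rw [christoffelPattern_eq_zero_of_lt h, zero_mul]
  · rw [christoffelPattern_eq_zero_of_le h, mul_zero]

/-- The curvature components of `M_f` divided by `f''`. -/
def curvaturePattern (a b c d : Fin 4) : ℝ :=
  ((if a = 0 ∧ b = 1 then 1 else 0) - if a = 1 ∧ b = 0 then 1 else 0) *
    ((if c = 1 ∧ d = 0 then 1 else 0) - if c = 0 ∧ d = 1 then 1 else 0)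

theorem planeWave_partialDeriv_christoffel (a l i j : Fin 4) (p : Fin 4 → ℝ) :
    partialDeriv a ((planeWave f hf).christoffel l i j) p =
      if a = 1 then deriv (deriv f) (p 1) * christoffelPattern l i j else 0 := by
  have hd : DifferentiableAt ℝ (deriv f) (p 1) := (hf _ trivial).deriv.differentiableAt
  have h := partialDeriv_comp_apply (p := p) (k := 1) (hd.mul_const (christoffelPattern l i j)) a
  rw [deriv_mul_const hd] at h
  rw [← h]
  congr 1
  funext q
  exact planeWave_christoffel hf l i j q

theorem planeWave_curvature (p : Fin 4 → ℝ) (a b c d : Fin 4) :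
    (planeWave f hf).curvature p a b c d =
      deriv (deriv f) (p 1) * curvaturePattern a b c d := by
  have h0 : ∀ m, ∑ s, ((planeWave f hf).christoffel s b c p * (planeWave f hf).christoffel m a s p
        - (planeWave f hf).christoffel s a c p * (planeWave f hf).christoffel m b s p) = 0 := by
    intro m
    refine Finset.sum_eq_zero fun s _ => ?_
    simp only [planeWave_christoffel]
    linear_combination deriv f (p 1) ^ 2 * christoffelPattern_mul s m b c a -
      deriv f (p 1) ^ 2 * christoffelPattern_mul s m a c b
  simp only [PseudoRiemannianMetric.curvature, h0, planeWave_partialDeriv_christoffel, add_zero]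
  simp only [planeWave, Fin.sum_univ_four]
  generalize deriv (deriv f) (p 1) = F
  fin_cases a <;> fin_cases b <;> fin_cases d <;>
    simp [christoffelPattern, curvaturePattern] <;> fin_cases c <;> simp

theorem planeWave_nablaR_one (p : Fin 4 → ℝ) (idx : Fin (4 + 1) → Fin 4) :
    (planeWave f hf).nablaR 1 p idx = deriv (deriv (deriv f)) (p 1) *
      (curvaturePattern (idx 0) (idx 1) (idx 2) (idx 3) * if idx 4 = 1 then 1 else 0) := by
  have hd : DifferentiableAt ℝ (deriv (deriv f)) (p 1) :=
    (hf _ trivial).deriv.deriv.differentiableAt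
  -- Each connection term dies on one factor: Γ^l = 0 for l < 2, and R = 0 once a slot carries an
  -- index l ≥ 2.
  have h0 : ∀ s : Fin 4, ∀ l, ∀ J : Fin 4 → Fin 4, ∀ j,
      (planeWave f hf).christoffel l j (J s) p *
        (planeWave f hf).nablaR 0 p (Function.update J s l) = 0 := by
    intro s l J j
    simp only [planeWave_christoffel, PseudoRiemannianMetric.nablaR, planeWave_curvature]
    rcases lt_or_ge l 2 with h | h
    · simp [christoffelPattern_eq_zero_of_lt h]
    · have : l ≠ 0 ∧ l ≠ 1 := by constructor <;> rintro rfl <;> simp at h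
      fin_cases s <;> simp [curvaturePattern, Function.update, this]
  rw [PseudoRiemannianMetric.nablaR, PseudoRiemannianMetric.covDeriv,
    Finset.sum_eq_zero fun s _ => Finset.sum_eq_zero fun l _ => h0 s l _ _, sub_zero]
  simp only [PseudoRiemannianMetric.nablaR, planeWave_curvature]
  rw [partialDeriv_comp_apply (k := 1) (hd.mul_const _), deriv_mul_const hd]
  have : Fin.last (4 + 0) = 4 := rfl
  rw [this]
  split_ifs
  · rw [mul_one]; rfl
  · simp

end PlaneWave

/-! ### R and ∇R as multilinear forms; isomorphisms of models. -/

theorem PseudoRiemannianMetric.modelAt_isIso {ι κ : Type*} [Fintype ι] [DecidableEq ι] [Fintype κ]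
    [DecidableEq κ] {g : PseudoRiemannianMetric ι} {h : PseudoRiemannianMetric κ} {k : ℕ}
    {P : ι → ℝ} {Q : κ → ℝ} {Φ : (ι → ℝ) ≃ₗ[ℝ] (κ → ℝ)}
    (hform : ∀ u v, h.formAt Q (Φ u) (Φ v) = g.formAt P u v)
    (hA : ∀ n ≤ k, ∀ v : Fin (4 + n) → ι → ℝ,
      tensorOfComponents (h.nablaR n Q) (fun s => Φ (v s)) =
        tensorOfComponents (g.nablaR n P) v) :
    (g.modelAt k P).IsIso (h.modelAt k Q) Φ :=
  ⟨hform, fun i v => hA i (Nat.lt_succ_iff.1 i.2) v⟩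

theorem curvaturePattern_eq (a b c d : Fin 4) : curvaturePattern a b c d =
    (if a = 0 ∧ b = 1 ∧ c = 1 ∧ d = 0 then 1 else 0) -
      (if a = 0 ∧ b = 1 ∧ c = 0 ∧ d = 1 then 1 else 0) -
      (if a = 1 ∧ b = 0 ∧ c = 1 ∧ d = 0 then 1 else 0) +
      (if a = 1 ∧ b = 0 ∧ c = 0 ∧ d = 1 then 1 else 0) := by
  by_cases h : a = 0 ∧ b = 1
  · obtain ⟨rfl, rfl⟩ := h
    simp [curvaturePattern]
  by_cases h' : a = 1 ∧ b = 0
  · obtain ⟨rfl, rfl⟩ := h'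
    simp [curvaturePattern]
    ring
  · simp only [← and_assoc, h, h', curvaturePattern]
    simp

section PlaneWave

variable {f : ℝ → ℝ} (hf : AnalyticOnNhd ℝ f Set.univ)

theorem planeWave_tensor_zero (p : Fin 4 → ℝ) (v : Fin (4 + 0) → Fin 4 → ℝ) :
    tensorOfComponents ((planeWave f hf).nablaR 0 p) v = deriv (deriv f) (p 1) *
      ((v 0 0 * v 1 1 - v 0 1 * v 1 0) * (v 2 1 * v 3 0 - v 2 0 * v 3 1)) := by
  -- Four indicator tensors, each of which evaluates to a single monomial in the entries of `v`.
  have h : ∀ idx, (planeWave f hf).nablaR 0 p idx = deriv (deriv f) (p 1) *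
      ((Pi.single ![0, 1, 1, 0] 1 : (Fin 4 → Fin 4) → ℝ) idx
        - (Pi.single ![0, 1, 0, 1] 1 : (Fin 4 → Fin 4) → ℝ) idx
        - (Pi.single ![1, 0, 1, 0] 1 : (Fin 4 → Fin 4) → ℝ) idx
        + (Pi.single ![1, 0, 0, 1] 1 : (Fin 4 → Fin 4) → ℝ) idx) := by
    intro idx
    simp only [PseudoRiemannianMetric.nablaR, planeWave_curvature, curvaturePattern_eq,
      Pi.single_apply, funext_iff, Fin.forall_fin_succ]
    simp
  simp only [tensorOfComponents_apply, h]
  simp only [mul_assoc, add_mul, sub_mul, mul_add, mul_sub, Finset.sum_add_distrib,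
    Finset.sum_sub_distrib, ← Finset.mul_sum, ← tensorOfComponents_apply,
    tensorOfComponents_single]
  simp [Fin.prod_univ_four]
  ring

theorem planeWave_tensor_one (p : Fin 4 → ℝ) (v : Fin (4 + 1) → Fin 4 → ℝ) :
    tensorOfComponents ((planeWave f hf).nablaR 1 p) v = deriv (deriv (deriv f)) (p 1) *
      ((v 0 0 * v 1 1 - v 0 1 * v 1 0) * (v 2 1 * v 3 0 - v 2 0 * v 3 1) * v 4 1) := by
  have h : ∀ idx, (planeWave f hf).nablaR 1 p idx = deriv (deriv (deriv f)) (p 1) *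
      ((Pi.single ![0, 1, 1, 0, 1] 1 : (Fin 5 → Fin 4) → ℝ) idx
        - (Pi.single ![0, 1, 0, 1, 1] 1 : (Fin 5 → Fin 4) → ℝ) idx
        - (Pi.single ![1, 0, 1, 0, 1] 1 : (Fin 5 → Fin 4) → ℝ) idx
        + (Pi.single ![1, 0, 0, 1, 1] 1 : (Fin 5 → Fin 4) → ℝ) idx) := by
    intro idx
    simp only [planeWave_nablaR_one, curvaturePattern_eq,
      Pi.single_apply, funext_iff, Fin.forall_fin_succ]
    by_cases h4 : idx 4 = 1 <;> simp [h4]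
  simp only [tensorOfComponents_apply, h]
  simp only [mul_assoc, add_mul, sub_mul, mul_add, mul_sub, Finset.sum_add_distrib,
    Finset.sum_sub_distrib, ← Finset.mul_sum, ← tensorOfComponents_apply,
    tensorOfComponents_single]
  simp [Fin.prod_univ_five]
  ring

end PlaneWave

/-- The linear map with `∂_x ↦ a ∂_x + (c / a) ∂_x̃`, `∂_y ↦ b ∂_y`, `∂_x̃ ↦ a⁻¹ ∂_x̃`,
`∂_ỹ ↦ b⁻¹ ∂_ỹ`. -/
noncomputable def planeWaveLinearEquiv (a b c : ℝ) (ha : a ≠ 0) (hb : b ≠ 0) :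
    (Fin 4 → ℝ) ≃ₗ[ℝ] (Fin 4 → ℝ) where
  toFun u := ![a * u 0, b * u 1, a⁻¹ * (u 2 + c * u 0), b⁻¹ * u 3]
  invFun u := ![a⁻¹ * u 0, b⁻¹ * u 1, a * u 2 - c * (a⁻¹ * u 0), b * u 3]
  map_add' u v := by ext i; fin_cases i <;> simp <;> ring
  map_smul' r u := by ext i; fin_cases i <;> simp <;> ring
  left_inv u := by ext i; fin_cases i <;> simp [ha, hb]
  right_inv u := by ext i; fin_cases i <;> simp [ha, hb]

section Model

variable {f h : ℝ → ℝ} (hf : AnalyticOnNhd ℝ f Set.univ) (hh : AnalyticOnNhd ℝ h Set.univ)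
  {a b c : ℝ} {P Q : Fin 4 → ℝ}

/-- Scaling ∂_x by a turns its square norm into -2a²h; the shear adds 2c, which must bring it back
to -2f. -/
theorem formAt_planeWaveLinearEquiv (ha : a ≠ 0) (hb : b ≠ 0)
    (hc : c = a ^ 2 * h (Q 1) - f (P 1)) (u v : Fin 4 → ℝ) :
    (planeWave h hh).formAt Q (planeWaveLinearEquiv a b c ha hb u)
      (planeWaveLinearEquiv a b c ha hb v) = (planeWave f hf).formAt P u v := by
  simp only [planeWave_formAt]
  simp [planeWaveLinearEquiv, hc]
  field_simp
  ring

theorem tensor_zero_planeWaveLinearEquiv (ha : a ≠ 0) (hb : b ≠ 0)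
    (h2 : a ^ 2 * b ^ 2 * deriv (deriv h) (Q 1) = deriv (deriv f) (P 1))
    (v : Fin (4 + 0) → Fin 4 → ℝ) :
    tensorOfComponents ((planeWave h hh).nablaR 0 Q)
        (fun s => planeWaveLinearEquiv a b c ha hb (v s)) =
      tensorOfComponents ((planeWave f hf).nablaR 0 P) v := by
  rw [planeWave_tensor_zero, planeWave_tensor_zero, ← h2]
  simp [planeWaveLinearEquiv]
  ring

theorem tensor_one_planeWaveLinearEquiv (ha : a ≠ 0) (hb : b ≠ 0)
    (h3 : a ^ 2 * b ^ 3 * deriv (deriv (deriv h)) (Q 1) = deriv (deriv (deriv f)) (P 1))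
    (v : Fin (4 + 1) → Fin 4 → ℝ) :
    tensorOfComponents ((planeWave h hh).nablaR 1 Q)
        (fun s => planeWaveLinearEquiv a b c ha hb (v s)) =
      tensorOfComponents ((planeWave f hf).nablaR 1 P) v := by
  rw [planeWave_tensor_one, planeWave_tensor_one, ← h3]
  simp [planeWaveLinearEquiv]
  ring

theorem planeWave_isIso_zero (ha : a ≠ 0) (hb : b ≠ 0)
    (h2 : a ^ 2 * b ^ 2 * deriv (deriv h) (Q 1) = deriv (deriv f) (P 1)) :
    ∃ Φ, ((planeWave f hf).modelAt 0 P).IsIso ((planeWave h hh).modelAt 0 Q) Φ := by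
  refine ⟨planeWaveLinearEquiv a b _ ha hb, PseudoRiemannianMetric.modelAt_isIso
    (formAt_planeWaveLinearEquiv hf hh ha hb rfl) ?_⟩
  rintro (_ | n) hn v
  · exact tensor_zero_planeWaveLinearEquiv hf hh ha hb h2 v
  · omega

theorem planeWave_isIso_one (ha : a ≠ 0) (hb : b ≠ 0)
    (h2 : a ^ 2 * b ^ 2 * deriv (deriv h) (Q 1) = deriv (deriv f) (P 1))
    (h3 : a ^ 2 * b ^ 3 * deriv (deriv (deriv h)) (Q 1) = deriv (deriv (deriv f)) (P 1)) :
    ∃ Φ, ((planeWave f hf).modelAt 1 P).IsIso ((planeWave h hh).modelAt 1 Q) Φ := by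
  refine ⟨planeWaveLinearEquiv a b _ ha hb, PseudoRiemannianMetric.modelAt_isIso
    (formAt_planeWaveLinearEquiv hf hh ha hb rfl) ?_⟩
  intro n hn v
  obtain rfl | rfl := Nat.le_one_iff_eq_zero_or_eq_one.1 hn
  · exact tensor_zero_planeWaveLinearEquiv hf hh ha hb h2 v
  · exact tensor_one_planeWaveLinearEquiv hf hh ha hb h3 v

end Model

/-! ### Quadratic isometries. -/

/-- A quadratic map which carries `P` to `Q`; for suitable parameters it is an isometry between
generalized plane wave manifolds. -/
noncomputable def planeWaveMap (a b c d : ℝ) (ha : a ≠ 0) (hb : b ≠ 0) (P Q : Fin 4 → ℝ) :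
    (Fin 4 → ℝ) ≃ (Fin 4 → ℝ) where
  toFun p := ![Q 0 + a * (p 0 - P 0), Q 1 + b * (p 1 - P 1),
    Q 2 + a⁻¹ * (p 2 - P 2 + c * (p 0 - P 0) + d * (p 0 - P 0) * (p 1 - P 1)),
    Q 3 + b⁻¹ * (p 3 - P 3 - d / 2 * (p 0 - P 0) ^ 2)]
  invFun q := ![P 0 + a⁻¹ * (q 0 - Q 0), P 1 + b⁻¹ * (q 1 - Q 1),
    P 2 + a * (q 2 - Q 2) - c * (a⁻¹ * (q 0 - Q 0)) -
      d * (a⁻¹ * (q 0 - Q 0)) * (b⁻¹ * (q 1 - Q 1)),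
    P 3 + b * (q 3 - Q 3) + d / 2 * (a⁻¹ * (q 0 - Q 0)) ^ 2]
  left_inv p := by ext i; fin_cases i <;> simp <;> field_simp <;> ring
  right_inv p := by ext i; fin_cases i <;> simp <;> field_simp <;> ring

section Map

variable {a b c d : ℝ} (ha : a ≠ 0) (hb : b ≠ 0) (P Q : Fin 4 → ℝ)

theorem planeWaveMap_self : planeWaveMap a b c d ha hb P Q P = Q := by
  ext i; fin_cases i <;> simp [planeWaveMap]

theorem contDiff_planeWaveMap : ContDiff ℝ ∞ (planeWaveMap a b c d ha hb P Q) := by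
  rw [contDiff_pi]
  intro i
  fin_cases i <;> simp [planeWaveMap] <;> fun_prop

theorem contDiff_planeWaveMap_symm : ContDiff ℝ ∞ (planeWaveMap a b c d ha hb P Q).symm := by
  rw [contDiff_pi]
  intro i
  fin_cases i <;> simp [planeWaveMap] <;> fun_prop

theorem fderiv_planeWaveMap (p u : Fin 4 → ℝ) :
    fderiv ℝ (planeWaveMap a b c d ha hb P Q) p u = ![a * u 0, b * u 1,
      a⁻¹ * (u 2 + c * u 0 + d * (u 0 * (p 1 - P 1) + (p 0 - P 0) * u 1)),
      b⁻¹ * (u 3 - d * (p 0 - P 0) * u 0)] := by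
  have hx : ∀ j, HasFDerivAt (fun q : Fin 4 → ℝ => q j - P j)
    (ContinuousLinearMap.proj j : (Fin 4 → ℝ) →L[ℝ] ℝ) p :=
    fun j => (hasFDerivAt_apply j p).sub_const _
  have hdiff := (contDiff_planeWaveMap (c := c) (d := d) ha hb P Q).differentiable (by simp) p
  ext i
  have key : fderiv ℝ (planeWaveMap a b c d ha hb P Q) p u i =
      fderiv ℝ (fun q => planeWaveMap a b c d ha hb P Q q i) p u := by
    exact congrArg (fun L => L u) ((hasFDerivAt_pi'.1 hdiff.hasFDerivAt) i).fderiv.symm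
  rw [key]
  fin_cases i
  · have := ((hx 0).const_mul a).const_add (Q 0)
    simp [planeWaveMap, this.fderiv]
  · have := ((hx 1).const_mul b).const_add (Q 1)
    simp [planeWaveMap, this.fderiv]
  · have := ((((hx 2).add ((hx 0).const_mul c)).add
      (((hx 0).const_mul d).mul (hx 1))).const_mul a⁻¹).const_add (Q 2)
    refine (congrArg (fun L => L u) this.fderiv).trans ?_
    simp
    ring
  · have := (((hx 3).sub (((hx 0).pow 2).const_mul (d / 2))).const_mul b⁻¹).const_add (Q 3)
    refine (congrArg (fun L => L u) this.fderiv).trans ?_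
    simp
    left
    ring

/-- The x̃-component contributes 2(c + dt) dx² with t = y - P_y. It also produces a mixed dx dy
term, cancelled by the quadratic term of the ỹ-component. Hence dx² has coefficient -2a²h + 2(c +
dt) = -2f. -/
theorem isIsometry_planeWaveMap {f h : ℝ → ℝ} (hf : AnalyticOnNhd ℝ f Set.univ)
    (hh : AnalyticOnNhd ℝ h Set.univ)
    (H : ∀ t, a ^ 2 * h (Q 1 + b * t) = f (P 1 + t) + c + d * t) :
    (planeWave f hf).IsIsometry (planeWave h hh) (planeWaveMap a b c d ha hb P Q) := by
  refine ⟨contDiff_planeWaveMap ha hb P Q, contDiff_planeWaveMap_symm ha hb P Q, fun p u v => ?_⟩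
  have H' := H (p 1 - P 1)
  rw [add_sub_cancel] at H'
  have h1 : planeWaveMap a b c d ha hb P Q p 1 = Q 1 + b * (p 1 - P 1) := rfl
  rw [planeWave_formAt, planeWave_formAt, fderiv_planeWaveMap, fderiv_planeWaveMap, h1]
  simp
  field_simp
  linear_combination (-2 * u 0 * v 0) * H'

end Map

/-! ### Holonomy and irreducibility of M_{y²}. -/

section PlaneWave

variable {f : ℝ → ℝ} (hf : AnalyticOnNhd ℝ f Set.univ)

theorem planeWave_christoffel_apply (l : Fin 4) (p u v : Fin 4 → ℝ) :
    -∑ i, ∑ j, (planeWave f hf).christoffel l i j p * u i * v j =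
      ![0, 0, deriv f (p 1) * (u 0 * v 1 + u 1 * v 0), -(deriv f (p 1) * (u 0 * v 0))] l := by
  simp only [planeWave_christoffel]
  fin_cases l <;> simp [Fin.sum_univ_four, christoffelPattern] <;> ring

end PlaneWave

/-- A loop based at `P` in the directions of `x` and `y`. -/
noncomputable def planeLoop (P : Fin 4 → ℝ) (t : ℝ) : Fin 4 → ℝ :=
  ![P 0 + (t - t ^ 2), P 1 + (t - 3 * t ^ 2 + 2 * t ^ 3), P 2, P 3]

theorem hasDerivAt_planeLoop (P : Fin 4 → ℝ) (t : ℝ) :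
    HasDerivAt (planeLoop P) ![1 - 2 * t, 1 - 6 * t + 6 * t ^ 2, 0, 0] t := by
  rw [hasDerivAt_pi]
  intro i
  fin_cases i
  · refine (((hasDerivAt_id t).sub (hasDerivAt_pow 2 t)).const_add (P 0)).congr_deriv ?_
    simp
  · refine ((((hasDerivAt_id t).sub ((hasDerivAt_pow 2 t).const_mul 3)).add
      ((hasDerivAt_pow 3 t).const_mul 2)).const_add (P 1)).congr_deriv ?_
    simp
    ring
  · exact hasDerivAt_const t (P 2)
  · exact hasDerivAt_const t (P 3)

theorem contDiff_planeLoop (P : Fin 4 → ℝ) : ContDiff ℝ ∞ (planeLoop P) := by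
  rw [contDiff_pi]
  intro i
  fin_cases i <;> simp [planeLoop] <;> fun_prop

/-- The integral of `2 y dx` along `planeLoop P` up to time `t`. -/
noncomputable def loopArea (P : Fin 4 → ℝ) (t : ℝ) : ℝ :=
  2 * P 1 * (t - t ^ 2) + t ^ 2 - 10 / 3 * t ^ 3 + 4 * t ^ 4 - 8 / 5 * t ^ 5

theorem hasDerivAt_loopArea (P : Fin 4 → ℝ) (t : ℝ) :
    HasDerivAt (loopArea P) (2 * (P 1 + (t - 3 * t ^ 2 + 2 * t ^ 3)) * (1 - 2 * t)) t := by
  refine ((((((hasDerivAt_id t).sub (hasDerivAt_pow 2 t)).const_mul (2 * P 1)).add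
    (hasDerivAt_pow 2 t)).sub ((hasDerivAt_pow 3 t).const_mul (10 / 3))).add
    ((hasDerivAt_pow 4 t).const_mul 4)).sub ((hasDerivAt_pow 5 t).const_mul (8 / 5))
    |>.congr_deriv ?_
  simp
  ring

/-- The parallel field of `M_{y²}` along `planeLoop P` with initial value `w`. -/
noncomputable def loopField (P w : Fin 4 → ℝ) (t : ℝ) : Fin 4 → ℝ :=
  ![w 0, w 1, w 2 + w 1 * loopArea P t + w 0 * (planeLoop P t 1 ^ 2 - P 1 ^ 2),
    w 3 - w 0 * loopArea P t]

theorem planeWaveSq_isParallelAlong_loopField (P w : Fin 4 → ℝ) :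
    planeWaveSq.IsParallelAlong (planeLoop P) (loopField P w) := by
  intro t
  have hd : deriv (fun y : ℝ => y ^ 2) (planeLoop P t 1) = 2 * planeLoop P t 1 := by simp
  have hA := hasDerivAt_loopArea P t
  have hy := (hasDerivAt_pi.1 (hasDerivAt_planeLoop P t)) 1
  simp only [(hasDerivAt_planeLoop P t).deriv, planeWaveSq, planeWave_christoffel_apply, hd]
  rw [hasDerivAt_pi]
  intro l
  fin_cases l
  · exact hasDerivAt_const t (w 0)
  · exact hasDerivAt_const t (w 1)
  · refine (((hA.const_mul (w 1)).const_add (w 2)).add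
      (((hy.pow 2).sub_const (P 1 ^ 2)).const_mul (w 0))).congr_deriv ?_
    simp [planeLoop, loopField]
    ring
  · refine ((hA.const_mul (w 0)).const_sub (w 3)).congr_deriv ?_
    simp [planeLoop, loopField]
    ring

/-- Transport around `planeLoop P` is id + N/15, because `loopArea P 1 = 1/15` and the y-coordinate
returns to its initial value. -/
theorem planeWaveSq_isHolonomyInvariant_mem {P : Fin 4 → ℝ} {W : Submodule ℝ (Fin 4 → ℝ)}
    (hW : planeWaveSq.IsHolonomyInvariant P W) {w : Fin 4 → ℝ} (hw : w ∈ W) :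
    ![0, 0, w 1, -w 0] ∈ W := by
  have h0 : loopField P w 0 = w := by
    ext i; fin_cases i <;> simp [loopField, loopArea, planeLoop]
  have h1 := hW (planeLoop P) (loopField P w) (contDiff_planeLoop P)
    (by ext i; fin_cases i <;> simp [planeLoop])
    (by ext i; fin_cases i <;> simp [planeLoop]; norm_num)
    (planeWaveSq_isParallelAlong_loopField P w) (h0.symm ▸ hw)
  have h2 : ![0, 0, w 1, -w 0] = (15 : ℝ) • (loopField P w 1 - w) := by
    ext i
    simp only [Pi.sub_apply, Pi.smul_apply, smul_eq_mul]
    fin_cases i <;> simp [loopField, loopArea, planeLoop] <;> ring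
  rw [h2]
  exact W.smul_mem _ (W.sub_mem h1 hw)

/-- If W has no x, y components, it is totally isotropic, hence zero. Otherwise some Nw ≠ 0 lies in
W, and non-degeneracy yields v ∈ W with δ = g(Nw, v) ≠ 0. Up to sign δ is the determinant of the x,
y parts of w and v, so w, v, Nw, Nv span the tangent space. -/
theorem planeWaveSq_isIrreducible : planeWaveSq.IsIrreducible := by
  intro P W hW hnd
  have hN := fun {w} => planeWaveSq_isHolonomyInvariant_mem hW (w := w)
  by_cases hker : ∀ w ∈ W, w 0 = 0 ∧ w 1 = 0
  · left
    rw [Submodule.eq_bot_iff]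
    refine fun w hw => hnd w hw fun w' hw' => ?_
    rw [planeWaveSq, planeWave_formAt]
    simp [hker w hw, hker w' hw']
  · right
    push Not at hker
    obtain ⟨w, hw, hw01⟩ := hker
    have hne : (![0, 0, w 1, -w 0] : Fin 4 → ℝ) ≠ 0 := by
      intro h
      have h2 : w 1 = 0 := by simpa using congrFun h 2
      have h3 : w 0 = 0 := by simpa using congrFun h 3
      exact hw01 h3 h2
    obtain ⟨v, hv, hdet⟩ : ∃ v ∈ W, w 1 * v 0 - w 0 * v 1 ≠ 0 := by
      by_contra! hcon
      refine hne (hnd _ (hN hw) fun v hv => ?_)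
      rw [planeWaveSq, planeWave_formAt]
      simpa [sub_eq_add_neg] using hcon v hv
    set δ := w 1 * v 0 - w 0 * v 1 with hδ
    have e2 : (![0, 0, 1, 0] : Fin 4 → ℝ) ∈ W := by
      convert W.smul_mem δ⁻¹ (W.sub_mem (W.smul_mem (v 0) (hN hw)) (W.smul_mem (w 0) (hN hv)))
        using 1
      ext i
      simp only [Pi.sub_apply, Pi.smul_apply, smul_eq_mul]
      fin_cases i <;> simp
      · rw [eq_inv_mul_iff_mul_eq₀ hdet, hδ]; ring
      · right; ring
    have e3 : (![0, 0, 0, 1] : Fin 4 → ℝ) ∈ W := by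
      convert W.smul_mem δ⁻¹ (W.sub_mem (W.smul_mem (v 1) (hN hw)) (W.smul_mem (w 1) (hN hv)))
        using 1
      ext i
      simp only [Pi.sub_apply, Pi.smul_apply, smul_eq_mul]
      fin_cases i <;> simp
      · right; ring
      · rw [eq_inv_mul_iff_mul_eq₀ hdet, hδ]; ring
    rw [eq_top_iff]
    intro z _
    -- Cramer's rule matches the x, y parts using w and v; the remaining two coordinates are then
    -- corrected.
    have hz : z = (δ⁻¹ * (z 1 * v 0 - z 0 * v 1)) • w + (δ⁻¹ * (w 1 * z 0 - w 0 * z 1)) • v +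
        (z 2 - δ⁻¹ * (z 1 * v 0 - z 0 * v 1) * w 2 - δ⁻¹ * (w 1 * z 0 - w 0 * z 1) * v 2) •
          ![0, 0, 1, 0] +
        (z 3 - δ⁻¹ * (z 1 * v 0 - z 0 * v 1) * w 3 - δ⁻¹ * (w 1 * z 0 - w 0 * z 1) * v 3) •
          ![0, 0, 0, 1] := by
      ext i
      simp only [Pi.add_apply, Pi.smul_apply, smul_eq_mul]
      fin_cases i <;> simp <;> field_simp <;> rw [hδ] <;> ring
    rw [hz]
    exact W.add_mem (W.add_mem (W.add_mem (W.smul_mem _ hw) (W.smul_mem _ hv))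
      (W.smul_mem _ e2)) (W.smul_mem _ e3)

/-! ### Homogeneity, symmetry and modeling. -/

theorem planeWaveSq_isHomogeneous : planeWaveSq.IsHomogeneous := fun P Q =>
  ⟨planeWaveMap 1 1 (Q 1 ^ 2 - P 1 ^ 2) (2 * Q 1 - 2 * P 1) one_ne_zero one_ne_zero P Q,
    isIsometry_planeWaveMap _ _ _ _ _ _ (fun t => by ring), planeWaveMap_self _ _ _ _⟩

theorem planeWaveSq_isSymmetricSpace : planeWaveSq.IsSymmetricSpace := by
  intro P
  have h : (-1 : ℝ) ≠ 0 := by norm_num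
  -- The parameters come from (P - t)² = (P + t)² - 4Pt.
  refine ⟨planeWaveMap (-1) (-1) 0 (-4 * P 1) h h P P,
    isIsometry_planeWaveMap _ _ _ _ _ _ (fun t => by ring), planeWaveMap_self _ _ _ _, ?_⟩
  ext1 u
  rw [fderiv_planeWaveMap]
  ext i
  fin_cases i <;> simp

theorem planeWaveExp_isHomogeneous : planeWaveExp.IsHomogeneous := by
  intro P Q
  -- A translation in y multiplies e^y by a constant, which rescaling x undoes: a² e^Q = e^P.
  refine ⟨planeWaveMap (Real.exp ((P 1 - Q 1) / 2)) 1 0 0 (Real.exp_ne_zero _) one_ne_zero P Q,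
    isIsometry_planeWaveMap _ _ _ _ _ _ (fun t => ?_), planeWaveMap_self _ _ _ _⟩
  rw [← Real.exp_nat_mul, ← Real.exp_add]
  simp
  ring

theorem iteratedDeriv_two_eq (f : ℝ → ℝ) : iteratedDeriv 2 f = deriv (deriv f) := by
  rw [iteratedDeriv_succ, iteratedDeriv_one]

theorem iteratedDeriv_three_eq (f : ℝ → ℝ) : iteratedDeriv 3 f = deriv (deriv (deriv f)) := by
  rw [iteratedDeriv_succ, iteratedDeriv_two_eq]

theorem planeWave_isModeledOn_planeWaveSq {f : ℝ → ℝ} (hf : AnalyticOnNhd ℝ f Set.univ)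
    (h2 : ∀ y, 0 < iteratedDeriv 2 f y) :
    PseudoRiemannianMetric.IsModeledOn 0 (planeWave f hf) planeWaveSq := by
  refine ⟨planeWaveSq_isHomogeneous, 0, fun P => ?_⟩
  rw [iteratedDeriv_two_eq] at h2
  refine planeWave_isIso_zero (a := √(deriv (deriv f) (P 1) / 2)) (b := 1) hf _
    (Real.sqrt_pos.2 (half_pos (h2 _))).ne' one_ne_zero ?_
  rw [Real.sq_sqrt (half_pos (h2 _)).le]
  have : deriv (fun y : ℝ => y ^ 2) = fun y => 2 * y := by ext; simp
  rw [this, deriv_const_mul _ differentiableAt_fun_id]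
  simp

theorem planeWave_isModeledOn_planeWaveExp {f : ℝ → ℝ} (hf : AnalyticOnNhd ℝ f Set.univ)
    (h2 : ∀ y, 0 < iteratedDeriv 2 f y) (h3 : ∀ y, 0 < iteratedDeriv 3 f y) :
    PseudoRiemannianMetric.IsModeledOn 1 (planeWave f hf) planeWaveExp := by
  refine ⟨planeWaveExp_isHomogeneous, 0, fun P => ?_⟩
  rw [iteratedDeriv_two_eq] at h2
  rw [iteratedDeriv_three_eq] at h3
  have h2 := h2 (P 1)
  have h3 := h3 (P 1)
  set F := deriv (deriv f) (P 1)
  set G := deriv (deriv (deriv f)) (P 1)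
  have hpos : 0 < F ^ 3 / G ^ 2 := by positivity
  -- All derivatives of exp at 0 equal 1, so this solves a²b² = F, a²b³ = G.
  refine planeWave_isIso_one (a := √(F ^ 3 / G ^ 2)) (b := G / F) hf _
    (Real.sqrt_pos.2 hpos).ne' (by positivity) ?_ ?_
  · rw [Real.sq_sqrt hpos.le]
    simp
    field_simp
    rfl
  · rw [Real.sq_sqrt hpos.le]
    simp
    field_simp
    rfl

/-! ### Partial derivatives, and functions with vanishing Hessian. -/

section PartialDeriv

variable {ι : Type*} [Fintype ι] [DecidableEq ι] {h : (ι → ℝ) → ℝ}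

theorem ContDiff.partialDeriv (hh : ContDiff ℝ ∞ h) (i : ι) : ContDiff ℝ ∞ (partialDeriv i h) :=
  (hh.fderiv_right (m := ∞) (by simp)).clm_apply contDiff_const

theorem ContDiff.hasDerivAt_partialDeriv (hh : ContDiff ℝ ∞ h) (i : ι) (p : ι → ℝ) :
    HasDerivAt (fun t : ℝ => h (p + t • Pi.single i 1)) (_root_.partialDeriv i h p) 0 :=
  (hh.differentiable (by simp) p).hasFDerivAt.hasLineDerivAt (Pi.single i 1)

theorem ContDiff.partialDeriv_comm (hh : ContDiff ℝ ∞ h) (i j : ι) (p : ι → ℝ) :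
    _root_.partialDeriv i (_root_.partialDeriv j h) p =
      _root_.partialDeriv j (_root_.partialDeriv i h) p := by
  have hd : DifferentiableAt ℝ (fderiv ℝ h) p :=
    (hh.fderiv_right (m := ∞) (by simp)).differentiable (by simp) p
  have hs : IsSymmSndFDerivAt ℝ h p :=
    hh.contDiffAt.isSymmSndFDerivAt 
      (by simpa using WithTop.coe_le_coe.2 (le_top (a := (2 : ℕ∞))))
  have key : ∀ a b : ι, _root_.partialDeriv a (_root_.partialDeriv b h) p =
      fderiv ℝ (fderiv ℝ h) p (Pi.single a 1) (Pi.single b 1) := by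
    intro a b
    have := hd.hasFDerivAt.clm_apply (hasFDerivAt_const (Pi.single b (1 : ℝ)) p)
    refine (congrArg (fun L => L (Pi.single a 1)) this.fderiv).trans ?_
    simp
  rw [key, key, hs.eq]

theorem eq_of_partialDeriv_eq_zero (hh : ContDiff ℝ ∞ h) (h0 : ∀ i p, partialDeriv i h p = 0)
    (p q : ι → ℝ) : h p = h q := by
  refine is_const_of_fderiv_eq_zero (𝕜 := ℝ) (hh.differentiable (by simp)) (fun x => ?_) p q
  refine ContinuousLinearMap.coe_injective (LinearMap.pi_ext' fun i => ?_)
  ext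
  exact h0 i x

theorem partialDeriv_add {h k : (ι → ℝ) → ℝ} (hh : ContDiff ℝ ∞ h) (hk : ContDiff ℝ ∞ k) (i : ι)
    (p : ι → ℝ) :
    partialDeriv i (fun q => h q + k q) p = partialDeriv i h p + partialDeriv i k p := by
  simp only [partialDeriv]
  rw [fderiv_fun_add (hh.differentiable (by simp) p) (hk.differentiable (by simp) p)]
  rfl

theorem partialDeriv_const_mul {h : (ι → ℝ) → ℝ} (hh : ContDiff ℝ ∞ h) (c : ℝ) (i : ι)
    (p : ι → ℝ) : partialDeriv i (fun q => c * h q) p = c * partialDeriv i h p := by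
  simp only [partialDeriv]
  rw [fderiv_const_mul (hh.differentiable (by simp) p)]
  rfl

theorem partialDeriv_comp {F : ℝ → ℝ} {h : (ι → ℝ) → ℝ} (hh : ContDiff ℝ ∞ h) {p : ι → ℝ}
    (hF : DifferentiableAt ℝ F (h p)) (i : ι) :
    partialDeriv i (fun q => F (h q)) p = deriv F (h p) * partialDeriv i h p := by
  have := hF.hasDerivAt.comp_hasFDerivAt p (hh.differentiable (by simp) p).hasFDerivAt
  refine (congrArg (fun L => L (Pi.single i 1)) this.fderiv).trans ?_
  simp [partialDeriv]

end PartialDeriv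

/-- If `f'' ≠ 0` everywhere, then a function whose Hessian with respect to `M_f` vanishes is affine
in `x` and `y`. -/
theorem eq_affine_of_hessian_eq {f : ℝ → ℝ} (hf : AnalyticOnNhd ℝ f Set.univ)
    (h2 : ∀ y, deriv (deriv f) y ≠ 0) {u : (Fin 4 → ℝ) → ℝ} (hu : ContDiff ℝ ∞ u)
    (H : ∀ i j p, partialDeriv i (partialDeriv j u) p =
      deriv f (p 1) * ((if i = 0 ∧ j = 0 then 1 else 0) * partialDeriv 3 u p -
        (if i = 1 ∧ j = 0 ∨ i = 0 ∧ j = 1 then 1 else 0) * partialDeriv 2 u p)) :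
    ∃ a b e : ℝ, ∀ p, u p = a * p 0 + b * p 1 + e := by
  have hf' : ∀ y, DifferentiableAt ℝ (deriv f) y := fun y => (hf y trivial).deriv.differentiableAt
  have hu1 := fun i => hu.partialDeriv i
  have hu2 := fun i j => (hu1 j).partialDeriv i
  have c2 : ∀ p, partialDeriv 2 u p = partialDeriv 2 u 0 := fun p =>
    eq_of_partialDeriv_eq_zero (hu1 2) (fun i p => by rw [H]; simp) p 0
  have c3 : ∀ p, partialDeriv 3 u p = partialDeriv 3 u 0 := fun p =>
    eq_of_partialDeriv_eq_zero (hu1 3) (fun i p => by rw [H]; simp) p 0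
  have H00 : partialDeriv 0 (partialDeriv 0 u) = fun p => deriv f (p 1) * partialDeriv 3 u 0 := by
    funext p; rw [H, c3]; simp
  have H10 : partialDeriv 1 (partialDeriv 0 u) =
      fun p => deriv f (p 1) * -partialDeriv 2 u 0 := by
    funext p; rw [H, c2]; simp
  have H01 : partialDeriv 0 (partialDeriv 1 u) =
      fun p => deriv f (p 1) * -partialDeriv 2 u 0 := by
    funext p; rw [H, c2]; simp
  have H11 : partialDeriv 1 (partialDeriv 1 u) = fun _ => 0 := by
    funext p; rw [H]; simp
  -- Third derivatives commute: ∂_y∂_x∂_x u = f'' ∂_ỹ u, whereas ∂_x∂_y∂_x u = 0. The same argument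
  -- with ∂_y∂_x∂_y u = -f'' ∂_x̃ u gives `z2`.
  have z3 : partialDeriv 3 u 0 = 0 := by
    have := (hu1 0).partialDeriv_comm 1 0 0
    rw [H00, H10, partialDeriv_comp_apply ((hf' _).mul_const _),
      partialDeriv_comp_apply ((hf' _).mul_const _), deriv_mul_const (hf' _)] at this
    simpa [h2] using this
  have z2 : partialDeriv 2 u 0 = 0 := by
    have := (hu1 1).partialDeriv_comm 1 0 0
    rw [H01, H11, partialDeriv_comp_apply ((hf' _).mul_const _), deriv_mul_const (hf' _),
      partialDeriv_const] at this
    simpa [h2] using this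
  have hconst : ∀ j p, partialDeriv j u p = partialDeriv j u 0 := fun j p =>
    eq_of_partialDeriv_eq_zero (hu1 j) (fun i p => by rw [H, c2, c3, z2, z3]; simp) p 0
  refine ⟨partialDeriv 0 u 0, partialDeriv 1 u 0, u 0, fun p => ?_⟩
  set a := partialDeriv 0 u 0 with ha
  set b := partialDeriv 1 u 0 with hb
  have hp : ∀ j : Fin 4, ContDiff ℝ ∞ (fun p : Fin 4 → ℝ => p j) := fun j => contDiff_apply ℝ ℝ j
  have key := eq_of_partialDeriv_eq_zero
    (h := fun p => u p + (-a * p 0 + -b * p 1)) (by fun_prop) (fun i p => by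
      rw [partialDeriv_add hu (by fun_prop), partialDeriv_add (by fun_prop) (by fun_prop),
        partialDeriv_comp_apply (h := fun t => -a * t) (by fun_prop),
        partialDeriv_comp_apply (h := fun t => -b * t) (by fun_prop), hconst]
      fin_cases i <;> simp [← ha, ← hb, z2, z3]) p 0
  simp at key
  linarith

/-! ### Isometries preserve the connection. -/

section Isometry

variable {f₁ f₂ : ℝ → ℝ} {hf₁ : AnalyticOnNhd ℝ f₁ Set.univ} {hf₂ : AnalyticOnNhd ℝ f₂ Set.univ}
  {φ : (Fin 4 → ℝ) ≃ (Fin 4 → ℝ)}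

namespace PseudoRiemannianMetric.IsIsometry

theorem contDiff_component (hφ : (planeWave f₁ hf₁).IsIsometry (planeWave f₂ hf₂) φ) (l : Fin 4) :
    ContDiff ℝ ∞ (fun p => φ p l) :=
  (contDiff_pi.1 hφ.1) l

theorem fderiv_single (hφ : (planeWave f₁ hf₁).IsIsometry (planeWave f₂ hf₂) φ) (p : Fin 4 → ℝ)
    (i l : Fin 4) :
    fderiv ℝ φ p (Pi.single i 1) l = partialDeriv i (fun p => φ p l) p := by
  have := (hφ.1.differentiable (by simp) p).hasFDerivAt
  exact congrArg (fun L => L (Pi.single i 1)) ((hasFDerivAt_pi'.1 this) l).fderiv.symm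

theorem metric_eq (hφ : (planeWave f₁ hf₁).IsIsometry (planeWave f₂ hf₂) φ) (p : Fin 4 → ℝ)
    (i j : Fin 4) :
    -2 * f₂ (φ p 1) * (partialDeriv i (fun p => φ p 0) p * partialDeriv j (fun p => φ p 0) p) +
      partialDeriv i (fun p => φ p 0) p * partialDeriv j (fun p => φ p 2) p +
      partialDeriv i (fun p => φ p 2) p * partialDeriv j (fun p => φ p 0) p +
      partialDeriv i (fun p => φ p 1) p * partialDeriv j (fun p => φ p 3) p +
      partialDeriv i (fun p => φ p 3) p * partialDeriv j (fun p => φ p 1) p =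
    (planeWave f₁ hf₁).coeff p i j := by
  have := hφ.2.2 p (Pi.single i 1) (Pi.single j 1)
  rw [planeWave_formAt] at this
  simp only [hφ.fderiv_single] at this
  rw [this]
  simp [formAt, Matrix.toBilin'_single]

/-- The inverse metrics are related by the differential of an isometry. -/
theorem inv_metric_eq (hφ : (planeWave f₁ hf₁).IsIsometry (planeWave f₂ hf₂) φ) (p : Fin 4 → ℝ)
    (a b : Fin 4) :
    ∑ k, ∑ l, partialDeriv k (fun p => φ p a) p * ((planeWave f₁ hf₁).coeff p)⁻¹ k l *
      partialDeriv l (fun p => φ p b) p = ((planeWave f₂ hf₂).coeff (φ p))⁻¹ a b := by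
  set J : Matrix (Fin 4) (Fin 4) ℝ :=
    Matrix.of fun a k => partialDeriv k (fun p => φ p a) p
  have hJ : J.transpose * (planeWave f₂ hf₂).coeff (φ p) * J = (planeWave f₁ hf₁).coeff p := by
    ext i j
    rw [← hφ.metric_eq]
    simp [J, Matrix.mul_apply, Fin.sum_univ_four, planeWave]
    ring
  have hdet := (planeWave f₁ hf₁).nondegenerate p
  have h1 : (((planeWave f₁ hf₁).coeff p)⁻¹ * J.transpose * (planeWave f₂ hf₂).coeff (φ p)) * J
      = 1 := by
    rw [Matrix.mul_assoc, Matrix.mul_assoc, ← Matrix.mul_assoc J.transpose, hJ,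
      Matrix.nonsing_inv_mul _ hdet]
  have h2 : (J * ((planeWave f₁ hf₁).coeff p)⁻¹ * J.transpose) * (planeWave f₂ hf₂).coeff (φ p)
      = 1 := by
    rw [← mul_eq_one_comm.1 h1]
    simp only [Matrix.mul_assoc]
  rw [Matrix.inv_eq_left_inv h2]
  simp [J, Matrix.mul_apply, Fin.sum_univ_four]
  ring

/-- The derivative of `metric_eq` in the direction `∂_k`. -/
theorem deriv_metric_eq (hφ : (planeWave f₁ hf₁).IsIsometry (planeWave f₂ hf₂) φ) (p : Fin 4 → ℝ)
    (J : Fin 4 → Fin 4 → ℝ) (hJ : J = fun k a => partialDeriv k (fun p => φ p a) p)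
    (H : Fin 4 → Fin 4 → Fin 4 → ℝ)
    (hH : H = fun k i a => partialDeriv k (partialDeriv i (fun p => φ p a)) p) (k i j : Fin 4) :
    -2 * (deriv f₂ (φ p 1) * J k 1 * (J i 0 * J j 0) +
        f₂ (φ p 1) * (H k i 0 * J j 0 + J i 0 * H k j 0)) +
      (H k i 0 * J j 2 + J i 0 * H k j 2) + (H k i 2 * J j 0 + J i 2 * H k j 0) +
      (H k i 1 * J j 3 + J i 1 * H k j 3) + (H k i 3 * J j 1 + J i 3 * H k j 1) =
    if k = 1 ∧ i = 0 ∧ j = 0 then -2 * deriv f₁ (p 1) else 0 := by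
  subst hJ hH
  have hd := fun a => (hφ.contDiff_component a).partialDeriv
  have D := fun a i => (hd a i).hasDerivAt_partialDeriv k p
  have hF : HasDerivAt (fun t : ℝ => f₂ (φ (p + t • Pi.single k 1) 1))
      (deriv f₂ (φ p 1) * partialDeriv k (fun p => φ p 1) p) 0 := by
    have h0 := (hφ.contDiff_component 1).hasDerivAt_partialDeriv k p
    refine HasDerivAt.comp (h₂ := f₂) (0 : ℝ) ?_ h0
    simpa using (hf₂ _ trivial).differentiableAt.hasDerivAt
  have hL := ((((hF.const_mul (-2)).mul ((D 0 i).mul (D 0 j))).add ((D 0 i).mul (D 2 j))).add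
    ((D 2 i).mul (D 0 j))).add ((D 1 i).mul (D 3 j)) |>.add ((D 3 i).mul (D 1 j))
  have hR := ((planeWave f₁ hf₁).smooth i j).hasDerivAt_partialDeriv k p
  rw [planeWave_partialDeriv_coeff] at hR
  have := (hL.congr_of_eventuallyEq (Filter.Eventually.of_forall fun t =>
    (hφ.metric_eq (p + t • Pi.single k 1) i j).symm)).unique hR
  rw [← this]
  simp
  ring

/-- The transformation law of the Christoffel symbols with the upper index lowered: the Koszul
combination of three differentiated metric equations isolates the second derivatives of φ. -/
theorem christoffel_eq (hφ : (planeWave f₁ hf₁).IsIsometry (planeWave f₂ hf₂) φ) (p : Fin 4 → ℝ)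
    (J : Fin 4 → Fin 4 → ℝ) (hJ : J = fun k a => partialDeriv k (fun p => φ p a) p)
    (H : Fin 4 → Fin 4 → Fin 4 → ℝ)
    (hH : H = fun k i a => partialDeriv k (partialDeriv i (fun p => φ p a)) p) (i j k : Fin 4) :
    -2 * f₂ (φ p 1) * H i j 0 * J k 0 + H i j 0 * J k 2 + H i j 2 * J k 0 + H i j 1 * J k 3 +
      H i j 3 * J k 1 =
    deriv f₂ (φ p 1) * (J i 1 * J j 0 * J k 0 + J j 1 * J i 0 * J k 0 - J k 1 * J i 0 * J j 0) -
      deriv f₁ (p 1) * ((if i = 1 ∧ j = 0 ∧ k = 0 then 1 else 0) +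
        (if j = 1 ∧ i = 0 ∧ k = 0 then 1 else 0) - if k = 1 ∧ i = 0 ∧ j = 0 then 1 else 0) := by
  have hs : ∀ i j a, H i j a = H j i a := by
    intro i j a
    rw [hH]
    exact (hφ.contDiff_component a).partialDeriv_comm i j p
  have e1 := hφ.deriv_metric_eq p J hJ H hH i j k
  have e2 := hφ.deriv_metric_eq p J hJ H hH j i k
  have e3 := hφ.deriv_metric_eq p J hJ H hH k i j
  have hite : ∀ (q : Prop) [Decidable q], (if q then -2 * deriv f₁ (p 1) else 0) =
      -2 * deriv f₁ (p 1) * if q then 1 else 0 := by intro q _; split_ifs <;> simp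
  rw [hite] at e1 e2 e3
  simp only [hs j i, hs k i, hs k j] at e1 e2 e3
  linear_combination (e1 + e2 - e3) / 2

/-- Since Γ^x = Γ^y = 0 in the target, its coordinates x and y have zero Hessian, and this pulls
back. Concretely, `christoffel_eq` is contracted with the inverse metric through `inv_metric_eq`. -/
theorem hessian_eq (hφ : (planeWave f₁ hf₁).IsIsometry (planeWave f₂ hf₂) φ) {l : Fin 4}
    (hl : l = 0 ∨ l = 1) (i j : Fin 4) (p : Fin 4 → ℝ) :
    partialDeriv i (partialDeriv j (fun p => φ p l)) p =
      deriv f₁ (p 1) * ((if i = 0 ∧ j = 0 then 1 else 0) * partialDeriv 3 (fun p => φ p l) p -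
        (if i = 1 ∧ j = 0 ∨ i = 0 ∧ j = 1 then 1 else 0) *
          partialDeriv 2 (fun p => φ p l) p) := by
  have hinv := fun b => hφ.inv_metric_eq p l b
  have hC := hφ.christoffel_eq p _ rfl _ rfl i j
  simp only [planeWave_inv_coeff] at hinv
  have i0 := hinv 0
  have i1 := hinv 1
  have i2 := hinv 2
  have i3 := hinv 3
  have k0 := hC 0
  have k1 := hC 1
  have k2 := hC 2
  have k3 := hC 3
  have hor : (if i = 1 ∧ j = 0 ∨ i = 0 ∧ j = 1 then (1 : ℝ) else 0) =
      (if i = 1 ∧ j = 0 then 1 else 0) + if j = 1 ∧ i = 0 then 1 else 0 := by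
    fin_cases i <;> fin_cases j <;> simp
  rw [hor]
  have hite : (if i = 0 ∧ j = 0 then deriv f₁ (p 1) else 0) =
      deriv f₁ (p 1) * if i = 0 ∧ j = 0 then 1 else 0 := by
    split_ifs <;> simp
  set J : Fin 4 → Fin 4 → ℝ := fun k a => partialDeriv k (fun p => φ p a) p
  set H : Fin 4 → ℝ := fun a => partialDeriv i (partialDeriv j (fun p => φ p a)) p
  obtain rfl | rfl := hl
  · simp [Fin.sum_univ_four] at i0 i1 i2 i3 k0 k1 k2 k3
    rw [hite] at k1
    linear_combination J 2 0 * k0 + J 3 0 * k1 + (J 0 0 + 2 * f₁ (p 1) * J 2 0) * k2 +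
      J 1 0 * k3 + (2 * f₂ (φ p 1) * H 0 - H 2) * i0 - H 0 * i2 - H 1 * i3 - H 3 * i1 +
      deriv f₂ (φ p 1) * ((J i 1 * J j 0 + J j 1 * J i 0) * i0 - J i 0 * J j 0 * i1)
  · simp [Fin.sum_univ_four] at i0 i1 i2 i3 k0 k1 k2 k3
    rw [hite] at k1
    linear_combination J 2 1 * k0 + J 3 1 * k1 + (J 0 1 + 2 * f₁ (p 1) * J 2 1) * k2 +
      J 1 1 * k3 + (2 * f₂ (φ p 1) * H 0 - H 2) * i0 - H 0 * i2 - H 1 * i3 - H 3 * i1 +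
      deriv f₂ (φ p 1) * ((J i 1 * J j 0 + J j 1 * J i 0) * i0 - J i 0 * J j 0 * i1)

end PseudoRiemannianMetric.IsIsometry
end Isometry

/-! ### Rigidity of isometries and the invariants α_p. -/

section Isometry

variable {f₁ f₂ : ℝ → ℝ} {hf₁ : AnalyticOnNhd ℝ f₁ Set.univ} {hf₂ : AnalyticOnNhd ℝ f₂ Set.univ}
  {φ : (Fin 4 → ℝ) ≃ (Fin 4 → ℝ)}

namespace PseudoRiemannianMetric.IsIsometry

/-- The last identity expresses invariance of R(∂_x, ∂_y, ∂_y, ∂_x), derived here from the metric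
alone. The xx, xy and yy equations prescribe ∂_x P, ∂_y P + ∂_x Q and ∂_y Q, and the identity is
their integrability condition ∂_y²(∂_x P) + ∂_x²(∂_y Q) = ∂_x∂_y(∂_y P + ∂_x Q). -/
theorem exists_affine_components
    (hφ : (planeWave f₁ hf₁).IsIsometry (planeWave f₂ hf₂) φ)
    (h2 : ∀ y, deriv (deriv f₁) y ≠ 0) :
    ∃ a b e c d e' : ℝ, (∀ p, φ p 0 = a * p 0 + b * p 1 + e) ∧
      (∀ p, φ p 1 = c * p 0 + d * p 1 + e') ∧
      ∀ p, (a * d - b * c) ^ 2 * deriv (deriv f₂) (φ p 1) = deriv (deriv f₁) (p 1) := by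
  obtain ⟨a, b, e, h0⟩ := eq_affine_of_hessian_eq hf₁ h2 (hφ.contDiff_component 0)
    (hφ.hessian_eq (Or.inl rfl))
  obtain ⟨c, d, e', h1⟩ := eq_affine_of_hessian_eq hf₁ h2 (hφ.contDiff_component 1)
    (hφ.hessian_eq (Or.inr rfl))
  refine ⟨a, b, e, c, d, e', h0, h1, fun p => ?_⟩
  have hc := hφ.contDiff_component
  have affine : ∀ (a b e : ℝ) (i : Fin 4) (p : Fin 4 → ℝ),
      partialDeriv i (fun p : Fin 4 → ℝ => a * p 0 + b * p 1 + e) p = ![a, b, 0, 0] i := by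
    intro a b e i p
    rw [partialDeriv_add (by fun_prop) (by fun_prop), partialDeriv_add (by fun_prop) (by fun_prop),
      partialDeriv_comp_apply (h := fun t => a * t) (by fun_prop),
      partialDeriv_comp_apply (h := fun t => b * t) (by fun_prop), partialDeriv_const]
    fin_cases i <;> simp
  have hJ0 : ∀ i p, partialDeriv i (fun p => φ p 0) p = ![a, b, 0, 0] i := fun i p => by
    rw [funext h0, affine]
  have hJ1 : ∀ i p, partialDeriv i (fun p => φ p 1) p = ![c, d, 0, 0] i := fun i p => by
    rw [funext h1, affine]
  have hdf : ∀ y, DifferentiableAt ℝ f₂ y := fun y => (hf₂ y trivial).differentiableAt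
  have hddf : ∀ y, DifferentiableAt ℝ (deriv f₂) y :=
    fun y => (hf₂ y trivial).deriv.differentiableAt
  have hddf₁ : ∀ y, DifferentiableAt ℝ (deriv f₁) y :=
    fun y => (hf₁ y trivial).deriv.differentiableAt
  have hf₁d : ∀ y, DifferentiableAt ℝ f₁ y := fun y => (hf₁ y trivial).differentiableAt
  set F : (Fin 4 → ℝ) → ℝ := fun p => f₂ (φ p 1) with hF
  set F' : (Fin 4 → ℝ) → ℝ := fun p => deriv f₂ (φ p 1) with hF'
  have hsmooth : ∀ {h : ℝ → ℝ}, AnalyticOnNhd ℝ h Set.univ → ContDiff ℝ ∞ h :=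
    fun h => contDiffOn_univ.mp h.contDiffOn_of_completeSpace
  have hFs : ContDiff ℝ ∞ F := (hsmooth hf₂).comp (hc 1)
  have hF's : ContDiff ℝ ∞ F' := (hsmooth hf₂.deriv).comp (hc 1)
  have hx : ContDiff ℝ ∞ (fun p : Fin 4 → ℝ => f₁ (p 1)) :=
    (hsmooth hf₁).comp (contDiff_apply ℝ ℝ 1)
  have hx' : ContDiff ℝ ∞ (fun p : Fin 4 → ℝ => deriv f₁ (p 1)) :=
    (hsmooth hf₁.deriv).comp (contDiff_apply ℝ ℝ 1)
  have dF : ∀ i, partialDeriv i F = fun p => ![c, d, 0, 0] i * F' p := fun i => by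
    funext p
    rw [partialDeriv_comp (hc 1) (hdf _), hJ1, mul_comm]
  have dF' : ∀ i p, partialDeriv i F' p = ![c, d, 0, 0] i * deriv (deriv f₂) (φ p 1) :=
    fun i p => by rw [partialDeriv_comp (hc 1) (hddf _), hJ1, mul_comm]
  -- P and Q collect the x̃, ỹ components of φ with the weights with which they enter the
  -- pulled-back metric along ∂_x and ∂_y.
  set P : (Fin 4 → ℝ) → ℝ := fun p => a * φ p 2 + c * φ p 3 with hP
  set Q : (Fin 4 → ℝ) → ℝ := fun p => b * φ p 2 + d * φ p 3 with hQ
  have hPs : ContDiff ℝ ∞ P := (contDiff_const.mul (hc 2)).add (contDiff_const.mul (hc 3))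
  have hQs : ContDiff ℝ ∞ Q := (contDiff_const.mul (hc 2)).add (contDiff_const.mul (hc 3))
  have dP : ∀ i p, partialDeriv i P p =
      a * partialDeriv i (fun p => φ p 2) p + c * partialDeriv i (fun p => φ p 3) p := by
    intro i p
    rw [partialDeriv_add (contDiff_const.mul (hc 2)) (contDiff_const.mul (hc 3)),
      partialDeriv_const_mul (hc 2), partialDeriv_const_mul (hc 3)]
  have dQ : ∀ i p, partialDeriv i Q p =
      b * partialDeriv i (fun p => φ p 2) p + d * partialDeriv i (fun p => φ p 3) p := by
    intro i p
    rw [partialDeriv_add (contDiff_const.mul (hc 2)) (contDiff_const.mul (hc 3)),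
      partialDeriv_const_mul (hc 2), partialDeriv_const_mul (hc 3)]
  have hP0 : partialDeriv 0 P = fun p => a ^ 2 * F p + -1 * f₁ (p 1) := by
    funext p
    have := hφ.metric_eq p 0 0
    simp [hJ0, hJ1, planeWave] at this
    rw [dP, hF]
    linear_combination this / 2
  have hQ1 : partialDeriv 1 Q = fun p => b ^ 2 * F p := by
    funext p
    have := hφ.metric_eq p 1 1
    simp [hJ0, hJ1, planeWave] at this
    rw [dQ, hF]
    linear_combination this / 2
  have hPQ : (fun p => partialDeriv 1 P p + partialDeriv 0 Q p) = fun p => 2 * a * b * F p := by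
    funext p
    have := hφ.metric_eq p 0 1
    simp [hJ0, hJ1, planeWave] at this
    rw [dP, dQ, hF]
    linear_combination this
  have hP01 : partialDeriv 0 (partialDeriv 1 P) =
      fun p => a ^ 2 * d * F' p + -1 * deriv f₁ (p 1) := by
    funext p
    rw [hPs.partialDeriv_comm, hP0,
      partialDeriv_add (contDiff_const.mul hFs) (contDiff_const.mul hx),
      partialDeriv_const_mul hFs, partialDeriv_const_mul hx, dF, partialDeriv_comp_apply (hf₁d _)]
    simp
    ring
  have hQ10 : partialDeriv 1 (partialDeriv 0 Q) = fun p => b ^ 2 * c * F' p := by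
    funext p
    rw [hQs.partialDeriv_comm, hQ1, partialDeriv_const_mul hFs, dF]
    simp
    ring
  have hmix :
      partialDeriv 1 (partialDeriv 0 (fun p => partialDeriv 1 P p + partialDeriv 0 Q p)) p =
      partialDeriv 1 (partialDeriv 0 (partialDeriv 1 P)) p +
        partialDeriv 0 (partialDeriv 1 (partialDeriv 0 Q)) p := by
    have : partialDeriv 0 (fun p => partialDeriv 1 P p + partialDeriv 0 Q p) =
        fun p => partialDeriv 0 (partialDeriv 1 P) p + partialDeriv 0 (partialDeriv 0 Q) p :=
      funext fun p => partialDeriv_add (hPs.partialDeriv 1) (hQs.partialDeriv 0) 0 p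
    rw [this, partialDeriv_add ((hPs.partialDeriv 1).partialDeriv 0)
      ((hQs.partialDeriv 0).partialDeriv 0), (hQs.partialDeriv 0).partialDeriv_comm 1 0]
  have hPQ0 : partialDeriv 0 (fun p => 2 * a * b * F p) = fun p => 2 * a * b * c * F' p := by
    funext p
    rw [partialDeriv_const_mul hFs, dF]
    simp
    ring
  rw [hPQ, hPQ0, hP01, hQ10,
    partialDeriv_add (contDiff_const.mul hF's) (contDiff_const.mul hx'),
    partialDeriv_const_mul hF's, partialDeriv_const_mul hF's, partialDeriv_const_mul hF's,
    partialDeriv_const_mul hx', partialDeriv_comp_apply (hddf₁ _), dF', dF'] at hmix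
  simp at hmix
  linear_combination -hmix

theorem exists_snd_deriv_eq (hφ : (planeWave f₁ hf₁).IsIsometry (planeWave f₂ hf₂) φ)
    (h2 : ∀ y, deriv (deriv f₁) y ≠ 0) (h3 : ∀ y, deriv (deriv (deriv f₂)) y ≠ 0) :
    ∃ D d e : ℝ, D ≠ 0 ∧ d ≠ 0 ∧ (∀ p, φ p 1 = d * p 1 + e) ∧
      ∀ y, deriv (deriv f₁) y = D * deriv (deriv f₂) (d * y + e) := by
  obtain ⟨a, b, e, c, d, e', h0, h1, h⟩ := hφ.exists_affine_components h2
  have hdet : a * d - b * c ≠ 0 := fun h' => h2 ((0 : Fin 4 → ℝ) 1) (by rw [← h 0, h']; simp)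
  -- f₁'' does not depend on x, but f₂''(cx + dy + e') would if c ≠ 0, because f₂''' ≠ 0.
  have hc : c = 0 := by
    have hd : DifferentiableAt ℝ (deriv (deriv f₂)) (φ 0 1) :=
      (hf₂ _ trivial).deriv.deriv.differentiableAt
    have hd' := hd.hasDerivAt
    have hl : HasDerivAt (fun t : ℝ => c * t + e') c 0 := by
      simpa using ((hasDerivAt_id (0 : ℝ)).const_mul c).add_const e'
    have hcomp : HasDerivAt (fun t : ℝ => deriv (deriv f₂) (c * t + e'))
        (deriv (deriv (deriv f₂)) (φ 0 1) * c) 0 :=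
      HasDerivAt.comp (h₂ := deriv (deriv f₂)) (0 : ℝ) (by simpa [h1] using hd') hl
    have hconst : HasDerivAt (fun t : ℝ => deriv (deriv f₂) (c * t + e')) 0 0 := by
      refine (hasDerivAt_const (0 : ℝ) (deriv (deriv f₂) e')).congr_of_eventuallyEq
        (Filter.Eventually.of_forall fun t => ?_)
      have e1 := h ![t, 0, 0, 0]
      have e2 := h 0
      simp [h1] at e1 e2
      rw [← e2] at e1
      exact mul_left_cancel₀ (pow_ne_zero 2 hdet) e1
    simpa [h3] using hcomp.unique hconst
  subst hc
  have hd : d ≠ 0 := by rintro rfl; simp at hdet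
  refine ⟨_, d, e', pow_ne_zero 2 hdet, hd, fun p => by rw [h1]; ring, fun y => ?_⟩
  have := h ![0, y, 0, 0]
  simp [h1] at this
  simp [← this]

end PseudoRiemannianMetric.IsIsometry

theorem iteratedDeriv_comp_affine {f : ℝ → ℝ} (hf : ContDiff ℝ ∞ f) (n : ℕ) (b c t : ℝ) :
    iteratedDeriv n (fun y => f (b * y + c)) t = b ^ n * iteratedDeriv n f (b * t + c) := by
  have h1 : ContDiff ℝ n (fun y => f (y + c)) := 
    (hf.comp (by fun_prop)).of_le (by exact_mod_cast le_top)
  have := congrFun (iteratedDeriv_comp_const_mul h1 b) t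
  rw [this, iteratedDeriv_comp_add_const]

/-- The derivative of order k + 2 scales by D d^k, so α_p scales by D^(1 + (p-1) - p) d^(p - p) = 1.
-/
theorem alphaInv_eq_of_isIsometry
    (hφ : (planeWave f₁ hf₁).IsIsometry (planeWave f₂ hf₂) φ)
    (h2 : ∀ y, deriv (deriv f₁) y ≠ 0) (h3 : ∀ y, deriv (deriv (deriv f₂)) y ≠ 0) (p : ℕ)
    (hp : 2 ≤ p) (P : Fin 4 → ℝ) :
    alphaInv p f₁ (P 1) = alphaInv p f₂ (φ P 1) := by
  obtain ⟨D, d, e, hD, hd, h1, h⟩ := hφ.exists_snd_deriv_eq h2 h3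
  have key : ∀ k, iteratedDeriv (k + 2) f₁ (P 1) =
      D * d ^ k * iteratedDeriv (k + 2) f₂ (φ P 1) := by
    intro k
    have hs : ContDiff ℝ ∞ (deriv (deriv f₂)) :=
      contDiffOn_univ.mp hf₂.deriv.deriv.contDiffOn_of_completeSpace
    rw [iteratedDeriv_succ', iteratedDeriv_succ', iteratedDeriv_succ', iteratedDeriv_succ',
      funext h, iteratedDeriv_const_mul_field, iteratedDeriv_comp_affine hs, h1]
    ring
  have k0 := key 0
  have k1 := key 1
  obtain ⟨q, rfl⟩ : ∃ q, p = q + 1 := ⟨p - 1, by omega⟩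
  have h3' : iteratedDeriv 3 f₂ (φ P 1) ≠ 0 := by
    rw [iteratedDeriv_three_eq]; exact h3 _
  simp only [zero_add, pow_zero, mul_one, Nat.reduceAdd, pow_one] at k0 k1
  simp only [alphaInv, key (q + 1), k0, k1, Nat.add_sub_cancel]
  field_simp
  ring

/-- Two analytic functions on `ℝ` all of whose derivatives agree at a point are equal. -/
theorem AnalyticOnNhd.eq_of_iteratedDeriv_eq {f h : ℝ → ℝ} (hf : AnalyticOnNhd ℝ f Set.univ)
    (hh : AnalyticOnNhd ℝ h Set.univ) {x : ℝ}
    (H : ∀ n, iteratedDeriv n f x = iteratedDeriv n h x) : f = h := by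
  refine hf.eq_of_eventuallyEq hh (z₀ := x) ?_
  have h1 := (hf x trivial).hasFPowerSeriesAt
  have h2 := (hh x trivial).hasFPowerSeriesAt
  simp only [H] at h1
  have h3 := (h1.sub h2)
  rw [sub_self] at h3
  filter_upwards [h3.eventually_eq_zero] with z hz
  exact sub_eq_zero.1 hz

theorem exists_isometry_of_alphaInv_eq (hf₁ : AnalyticOnNhd ℝ f₁ Set.univ)
    (hf₂ : AnalyticOnNhd ℝ f₂ Set.univ) {P Q : Fin 4 → ℝ}
    (h12 : 0 < iteratedDeriv 2 f₁ (P 1)) (h13 : 0 < iteratedDeriv 3 f₁ (P 1))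
    (h22 : 0 < iteratedDeriv 2 f₂ (Q 1)) (h23 : 0 < iteratedDeriv 3 f₂ (Q 1))
    (hα : ∀ p, 2 ≤ p → alphaInv p f₁ (P 1) = alphaInv p f₂ (Q 1)) :
    ∃ φ, (planeWave f₁ hf₁).IsIsometry (planeWave f₂ hf₂) φ ∧ φ P = Q := by
  set A := iteratedDeriv 2 f₁ (P 1) with hA
  set B := iteratedDeriv 3 f₁ (P 1) with hB
  set A' := iteratedDeriv 2 f₂ (Q 1) with hA'
  set B' := iteratedDeriv 3 f₂ (Q 1) with hB'
  -- Forced by a²b²A' = A and a²b³B' = B, the matching at orders 2 and 3.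
  set b := B * A' / (A * B') with hb
  have hbpos : 0 < b := by positivity
  have hpos : 0 < A / (A' * b ^ 2) := by positivity
  set a := √(A / (A' * b ^ 2)) with ha
  have hapos : 0 < a := Real.sqrt_pos.2 hpos
  have ha2 : a ^ 2 = A / (A' * b ^ 2) := Real.sq_sqrt hpos.le
  have key : ∀ k, a ^ 2 * b ^ (k + 2) * iteratedDeriv (k + 2) f₂ (Q 1) =
      iteratedDeriv (k + 2) f₁ (P 1) := by
    intro k
    rw [ha2]
    obtain rfl | rfl | hk : k = 0 ∨ k = 1 ∨ 2 ≤ k := by omega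
    · simp only [zero_add, ← hA, ← hA']
      field_simp
    · simp only [Nat.reduceAdd, ← hB, ← hB']
      rw [hb]
      field_simp
    · have := hα k hk
      obtain ⟨q, rfl⟩ : ∃ q, k = q + 1 := ⟨k - 1, by omega⟩
      simp only [alphaInv, ← hA, ← hA', ← hB, ← hB', Nat.add_sub_cancel] at this
      have e1 : iteratedDeriv (q + 1 + 2) f₁ (P 1) =
          iteratedDeriv (q + 1 + 2) f₂ (Q 1) * A' ^ q * (B' ^ (q + 1))⁻¹ * B ^ (q + 1) / A ^ q := by
        rw [← this]
        field_simp
      rw [e1, hb]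
      simp only [div_pow, mul_pow, pow_succ]
      field_simp
  set G : ℝ → ℝ := fun t => a ^ 2 * f₂ (b * t + Q 1) with hG
  -- The affine correction settles orders 0 and 1, which the α_p do not see. The factor `1 *` fits
  -- the form of `iteratedDeriv_comp_affine`.
  set K : ℝ → ℝ := fun t => f₁ (1 * t + P 1) +
    ((a ^ 2 * f₂ (Q 1) - f₁ (P 1)) + (a ^ 2 * b * deriv f₂ (Q 1) - deriv f₁ (P 1)) * t) with hK
  have haff : ∀ b c : ℝ, AnalyticOnNhd ℝ (fun t : ℝ => b * t + c) Set.univ := fun b c =>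
    (analyticOnNhd_const.mul analyticOnNhd_id).add analyticOnNhd_const
  have hs : ∀ {h : ℝ → ℝ}, AnalyticOnNhd ℝ h Set.univ → ContDiff ℝ ∞ h :=
    fun h => contDiffOn_univ.mp h.contDiffOn_of_completeSpace
  have hGK : G = K := by
    have hGa : AnalyticOnNhd ℝ G Set.univ := analyticOnNhd_const.mul
      (hf₂.comp (haff b (Q 1)) (Set.mapsTo_univ _ _))
    have hK1 : AnalyticOnNhd ℝ (fun t => f₁ (1 * t + P 1)) Set.univ :=
      hf₁.comp (haff 1 (P 1)) (Set.mapsTo_univ _ _)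
    have hK2 : ∀ c d : ℝ, AnalyticOnNhd ℝ (fun t : ℝ => c + d * t) Set.univ := fun c d =>
      analyticOnNhd_const.add (analyticOnNhd_const.mul analyticOnNhd_id)
    refine hGa.eq_of_iteratedDeriv_eq (x := 0) (hK1.add (hK2 _ _)) fun n => ?_
    have hd : ∀ c d : ℝ, deriv (fun t : ℝ => c + d * t) = fun _ => d := by
      intro c d
      ext t
      simp
    have hdd : ∀ (k : ℕ) (c d : ℝ), iteratedDeriv (k + 2) (fun t : ℝ => c + d * t) 0 = 0 := by
      intro k c d
      rw [iteratedDeriv_succ', iteratedDeriv_succ', hd]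
      simp
    have e1 : iteratedDeriv n K 0 = _ := iteratedDeriv_add (n := n) (x := (0 : ℝ))
      ((hs hK1).contDiffAt.of_le (by exact_mod_cast le_top))
      ((hs (hK2 _ _)).contDiffAt.of_le (by exact_mod_cast le_top))
    rw [e1, hG, iteratedDeriv_const_mul_field, iteratedDeriv_comp_affine (hs hf₂),
      iteratedDeriv_comp_affine (hs hf₁)]
    simp only [mul_zero, zero_add, one_pow, one_mul]
    obtain rfl | rfl | ⟨k, rfl⟩ : n = 0 ∨ n = 1 ∨ ∃ k, n = k + 2 := by
      rcases n with _ | _ | k <;> simp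
    · simp
    · simp only [iteratedDeriv_one, hd]
      ring
    · rw [← mul_assoc, key, hdd, add_zero]
  refine ⟨planeWaveMap a b (a ^ 2 * f₂ (Q 1) - f₁ (P 1))
      (a ^ 2 * b * deriv f₂ (Q 1) - deriv f₁ (P 1)) hapos.ne' hbpos.ne' P Q,
    isIsometry_planeWaveMap _ _ _ _ _ _ fun t => ?_, planeWaveMap_self _ _ _ _⟩
  have := congrFun hGK t
  simp only [hG, hK, one_mul] at this
  rw [add_comm (Q 1), this, add_comm t]
  ring

end Isometry

theorem theorem1p6 :
    (planeWaveSq.IsSymmetricSpace ∧ planeWaveSq.IsIrreducible ∧ planeWaveSq.IsHomogeneous ∧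
      ∀ (f : ℝ → ℝ) (hf : AnalyticOnNhd ℝ f Set.univ),
        (∀ y, 0 < iteratedDeriv 2 f y) →
        PseudoRiemannianMetric.IsModeledOn 0 (planeWave f hf) planeWaveSq) ∧
    (planeWaveExp.IsHomogeneous ∧
      ∀ (f : ℝ → ℝ) (hf : AnalyticOnNhd ℝ f Set.univ),
        (∀ y, 0 < iteratedDeriv 2 f y) → (∀ y, 0 < iteratedDeriv 3 f y) →
        PseudoRiemannianMetric.IsModeledOn 1 (planeWave f hf) planeWaveExp) ∧
    (∀ (f₁ f₂ : ℝ → ℝ) (hf₁ : AnalyticOnNhd ℝ f₁ Set.univ) (hf₂ : AnalyticOnNhd ℝ f₂ Set.univ),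
      (∀ y, 0 < iteratedDeriv 2 f₁ y) → (∀ y, 0 < iteratedDeriv 3 f₁ y) →
      (∀ y, 0 < iteratedDeriv 2 f₂ y) → (∀ y, 0 < iteratedDeriv 3 f₂ y) →
      ∀ P₁ P₂ : Fin 4 → ℝ,
        (∃ φ : (Fin 4 → ℝ) ≃ (Fin 4 → ℝ),
            (planeWave f₁ hf₁).IsIsometry (planeWave f₂ hf₂) φ ∧ φ P₁ = P₂) ↔
          ∀ p : ℕ, 2 ≤ p → alphaInv p f₁ (P₁ 1) = alphaInv p f₂ (P₂ 1)) := by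
  refine ⟨⟨planeWaveSq_isSymmetricSpace, planeWaveSq_isIrreducible, planeWaveSq_isHomogeneous,
    fun f hf h2 => planeWave_isModeledOn_planeWaveSq hf h2⟩,
    ⟨planeWaveExp_isHomogeneous, fun f hf h2 h3 => planeWave_isModeledOn_planeWaveExp hf h2 h3⟩,
    fun f₁ f₂ hf₁ hf₂ h12 h13 h22 h23 P₁ P₂ => ⟨?_, fun h =>
      exists_isometry_of_alphaInv_eq hf₁ hf₂ (h12 _) (h13 _) (h22 _) (h23 _) h⟩⟩
  rintro ⟨φ, hφ, rfl⟩ p hp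
  rw [iteratedDeriv_two_eq] at h12
  rw [iteratedDeriv_three_eq] at h23
  exact alphaInv_eq_of_isIsometry hφ (fun y => (h12 y).ne') (fun y => (h23 y).ne') p hp P₁
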